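/- Let $(H,\langle\cdot,\cdot\rangle,\|\cdot\|)$ be a real Hilbert space and let $A:D(A)\subset H\to H$ be a (possibly unbounded) strictly positive self-adjoint operator, i.e. $A$ is self-adjoint and $\langle Ax,x\rangle\ge c\|x\|^2$ on $D(A)$ for some $c>0$. Let $H^1=D(A^{1/2})$ with $\langle u,v\rangle_1=\langle A^{1/2}u,A^{1/2}v\rangle$, and let $\mathcal H=H^1\times H^1\times H\times H$ with the product topology. Let $\alpha,\beta,\gamma,\kappa>0$ and $\eta\in\mathbb R$ (no sign condition is imposed on $\gamma-\alpha\beta$). Consider the system $$u_{ttt}+\alpha u_{tt}+\beta Au_t+\gamma Au=\eta A\theta,\qquad \theta_t+\kappa A\theta=-\eta Au_{tt}-\alpha\eta Au_t .$$ A weak solution with initial datum $\boldsymbol u_0\in\mathcal H$ is a function $\boldsymbol u=(u,v,w,\theta)\in\mathcal C([0,\infty),\mathcal H)$ with $\boldsymbol u(0)=\boldsymbol u_0$ such that, for every $t\ge 0$, $u_t=v$ and $v_t=w$ in $H$, and, for all $\varphi,\psi\in D(A)$, $$\tfrac{d}{dt}\langle w,\varphi\rangle+\alpha\langle w,\varphi\rangle+\beta\langle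 v,A\varphi\rangle+\gamma\langle u,A\varphi\rangle=\eta\langle\theta,A\varphi\rangle,$$ $$\tfrac{d}{dt}\langle\theta,\psi\rangle+\kappa\langle\theta,A\psi\rangle=-\eta\langle w,A\psi\rangle-\alpha\eta\langle v,A\psi\rangle$$ (one-sided derivatives at $t=0$). Then for every $\boldsymbol u_0\in\mathcal H$ there is a unique weak solution $\boldsymbol u\in\mathcal C([0,\infty),\mathcal H)$ with initial datum $\boldsymbol u_0$. Moreover, for every fixed $t\ge0$ the map $S(t):\boldsymbol u_0\mapsto\boldsymbol u(t)$ is a continuous linear operator on $\mathcal H$, and $(S(t))_{t\ge0}$ is a strongly continuous semigroup: $S(0)=I$, $S(s+t)=S(s)S(t)$ for all $s,t\ge0$, and $t\mapsto S(t)\boldsymbol u_0$ is continuous on $[0,\infty)$ for every $\boldsymbol u_0\in\mathcal H$. -/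

import Mathlib

open Filter Topology Set
open scoped NNReal

section SquareRoot

variable {H : Type*} [NormedAddCommGroup H] [InnerProductSpace ℝ H] [CompleteSpace H]

/-- `B` is a nonnegative self-adjoint square root of the (unbounded) operator `A`:
`B ∘ B = A`, including equality of the natural domains. -/
structure IsPositiveSqrt (B A : H →ₗ.[ℝ] H) : Prop where
  isSelfAdjoint : IsSelfAdjoint B
  nonneg : ∀ x : B.domain, 0 ≤ inner ℝ (B x) (x : H)
  mem_graph_iff : ∀ x y : H,
    (x, y) ∈ A.graph ↔ ∃ z : H, (x, z) ∈ B.graph ∧ (z, y) ∈ B.graph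

variable (H) in
/-- A strictly positive self-adjoint operator on the real Hilbert space `H`, in general unbounded:
`c ‖x‖² ≤ ⟪A x, x⟫` on the domain of `A`, for some `c > 0`. Density of the domain is part of
self-adjointness (`IsSelfAdjoint.dense_domain`). -/
structure StrictlyPositiveOperator where
  op : H →ₗ.[ℝ] H
  isSelfAdjoint : IsSelfAdjoint op
  exists_lower_bound : ∃ c : ℝ, 0 < c ∧
    ∀ x : op.domain, c * ‖(x : H)‖ ^ 2 ≤ inner ℝ (op x) (x : H)

/-- The square root of `1 - R` for a self-adjoint contraction `R`. -/
theorem exists_bounded_sqrt (R : H →L[ℝ] H) (hR : ‖R‖ ≤ 1) (hs : IsSelfAdjoint R) :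
    ∃ Y : H →L[ℝ] H, ‖Y‖ ≤ 1 ∧ IsSelfAdjoint Y ∧ (1 - Y) * (1 - Y) = 1 - R := by
  let Y : ℕ → (H →L[ℝ] H) := fun n => Nat.rec 0 (fun _ Z => (1 / 2 : ℝ) • (R + Z * Z)) n
  let y : ℕ → ℝ := fun n => Nat.rec 0 (fun _ z => (1 / 2 : ℝ) * (1 + z * z)) n
  have Y0 : Y 0 = 0 := rfl
  have y0 : y 0 = 0 := rfl
  have YS : ∀ n, Y (n + 1) = (1 / 2 : ℝ) • (R + Y n * Y n) := fun _ => rfl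
  have yS : ∀ n, y (n + 1) = (1 / 2 : ℝ) * (1 + y n * y n) := fun _ => rfl
  have ynn : ∀ n, 0 ≤ y n ∧ y n ≤ 1 := by
    intro n
    induction n with
    | zero => simp [y0]
    | succ n ih =>
      rw [yS]
      constructor <;> nlinarith [ih.1, ih.2]
  have ymono : Monotone y := by
    apply monotone_nat_of_le_succ
    intro n
    rw [yS]
    nlinarith [sq_nonneg (1 - y n)]
  have hYn : ∀ n, ‖Y n‖ ≤ y n := by
    intro n
    induction n with
    | zero => simp [Y0, y0]
    | succ n ih =>
      rw [YS, yS, norm_smul]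
      have h1 : ‖R + Y n * Y n‖ ≤ 1 + y n * y n :=
        (norm_add_le _ _).trans (add_le_add hR ((norm_mul_le _ _).trans
          (mul_le_mul ih ih (norm_nonneg _) (ynn n).1)))
      rw [Real.norm_of_nonneg (by norm_num)]
      linarith
  have hd : ∀ n, ‖Y (n + 1) - Y n‖ ≤ y (n + 1) - y n := by
    intro n
    induction n with
    | zero =>
      have := hYn 1
      simpa [Y0, y0] using this
    | succ n ih =>
      have e : Y (n + 1 + 1) - Y (n + 1) = (1 / 2 : ℝ) •
          (Y (n + 1) * (Y (n + 1) - Y n) + (Y (n + 1) - Y n) * Y n) := by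
        rw [YS (n + 1), YS n, ← YS n, ← smul_sub]
        congr 1
        noncomm_ring
      have f : y (n + 1 + 1) - y (n + 1) = (1 / 2 : ℝ) *
          (y (n + 1) * (y (n + 1) - y n) + (y (n + 1) - y n) * y n) := by
        rw [yS (n + 1)]
        nth_rewrite 3 [yS n]
        ring
      rw [e, f, norm_smul, Real.norm_of_nonneg (by norm_num)]
      have h0 : 0 ≤ y (n + 1) - y n := (norm_nonneg _).trans ih
      have h1 := (norm_mul_le (Y (n + 1)) (Y (n + 1) - Y n)).trans
        (mul_le_mul (hYn (n + 1)) ih (norm_nonneg _) (ynn (n + 1)).1)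
      have h2 := (norm_mul_le (Y (n + 1) - Y n) (Y n)).trans
        (mul_le_mul ih (hYn n) (norm_nonneg _) h0)
      have h3 := norm_add_le (Y (n + 1) * (Y (n + 1) - Y n)) ((Y (n + 1) - Y n) * Y n)
      linarith
  have hsum : Summable fun n => y (n + 1) - y n := by
    apply summable_of_sum_range_le (c := 1)
    · intro n
      exact sub_nonneg.2 (ymono n.le_succ)
    · intro n
      rw [Finset.sum_range_sub, y0]
      linarith [(ynn n).2]
  have hc : CauchySeq Y := by
    apply cauchySeq_of_dist_le_of_summable _ _ hsum
    intro n
    rw [dist_comm, dist_eq_norm]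
    exact hd n
  obtain ⟨Z, hZ⟩ := cauchySeq_tendsto_of_complete hc
  refine ⟨Z, ?_, ?_, ?_⟩
  · exact le_of_tendsto hZ.norm (Eventually.of_forall fun n => (hYn n).trans (ynn n).2)
  · have hsaY : ∀ n, IsSelfAdjoint (Y n) := by
      intro n
      induction n with
      | zero => rw [Y0]; exact IsSelfAdjoint.zero _
      | succ n ih =>
        rw [YS]
        refine IsSelfAdjoint.smul (IsSelfAdjoint.all _) (hs.add ?_)
        have := ih.pow 2
        rwa [pow_two] at this
    have h1 : Tendsto (fun n => star (Y n)) atTop (𝓝 (star Z)) :=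
      (continuous_star.tendsto Z).comp hZ
    have h2 : (fun n => star (Y n)) = Y := funext fun n => hsaY n
    rw [h2] at h1
    exact tendsto_nhds_unique h1 hZ
  · have h1 : Tendsto (fun n => Y (n + 1)) atTop (𝓝 Z) := hZ.comp (tendsto_add_atTop_nat 1)
    have h2 : Tendsto (fun n => Y (n + 1)) atTop (𝓝 ((1 / 2 : ℝ) • (R + Z * Z))) := by
      simp only [YS]
      exact ((hZ.mul hZ).const_add R).const_smul _
    have h3 := tendsto_nhds_unique h1 h2
    have h4 : R = (2 : ℝ) • Z - Z * Z := by
      have h5 : (2 : ℝ) • Z = R + Z * Z := by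
        conv_lhs => rw [h3]
        rw [smul_smul]
        norm_num
      rw [h5]
      abel
    rw [h4, two_smul]
    noncomm_ring

namespace StrictlyPositiveOperator

variable (A : StrictlyPositiveOperator H)

/-- The bounded inverse of `A`, together with its quantitative positivity. -/
theorem exists_inverse : ∃ c : ℝ, 0 < c ∧ ∃ G : H →L[ℝ] H,
    (∀ x y : H, (x, y) ∈ A.op.graph ↔ x = G y) ∧ IsSelfAdjoint G ∧
    ∀ y, c * ‖G y‖ ^ 2 ≤ inner ℝ y (G y) := by
  obtain ⟨c, hc, hA⟩ := A.exists_lower_bound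
  have hb : ∀ x y : H, (x, y) ∈ A.op.graph → c * ‖x‖ ^ 2 ≤ inner ℝ y x := by
    intro x y h
    obtain ⟨z, rfl, rfl⟩ := A.op.mem_graph_iff.1 h
    exact hA z
  have hb' : ∀ x y : H, (x, y) ∈ A.op.graph → ‖x‖ ≤ c⁻¹ * ‖y‖ := by
    intro x y h
    have h1 := (hb x y h).trans (real_inner_le_norm y x)
    rcases (norm_nonneg x).eq_or_lt with h0 | h0
    · rw [← h0]; positivity
    · rw [inv_mul_eq_div, le_div_iff₀ hc]
      have : (‖x‖ * c) * ‖x‖ ≤ ‖y‖ * ‖x‖ := by nlinarith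
      exact le_of_mul_le_mul_right this h0
  have hsym : ∀ x y x' y' : H, (x, y) ∈ A.op.graph → (x', y') ∈ A.op.graph →
      inner ℝ y x' = inner ℝ x y' := by
    intro x y x' y' h h'
    have h2 : (x', y') ∈ A.op.graph.adjoint := by
      rw [← LinearPMap.adjoint_graph_eq_graph_adjoint A.isSelfAdjoint.dense_domain,
        LinearPMap.isSelfAdjoint_def.1 A.isSelfAdjoint]
      exact h'
    have := (Submodule.mem_adjoint_iff _ _).1 h2 x y h
    exact sub_eq_zero.1 this
  let P : A.op.graph →ₗ[ℝ] H := (LinearMap.snd ℝ H H).comp A.op.graph.subtype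
  have hPval : ∀ p : A.op.graph, P p = (p : H × H).2 := fun _ => rfl
  have hcl : _root_.IsClosed (A.op.graph : Set (H × H)) := A.isSelfAdjoint.isClosed
  have : CompleteSpace A.op.graph := hcl.completeSpace_coe
  have hanti : AntilipschitzWith (Real.toNNReal (max c⁻¹ 1)) P := by
    apply AddMonoidHomClass.antilipschitz_of_bound
    intro p
    rw [Real.coe_toNNReal _ (le_max_of_le_right zero_le_one)]
    obtain ⟨⟨x, y⟩, hp⟩ := p
    change max ‖x‖ ‖y‖ ≤ max c⁻¹ 1 * ‖y‖
    apply max_le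
    · exact (hb' x y hp).trans (by gcongr; exact le_max_left _ _)
    · nlinarith [norm_nonneg y, le_max_right c⁻¹ (1 : ℝ)]
  have hPc : UniformContinuous P :=
    (uniformContinuous_snd).comp uniformContinuous_subtype_val
  have hrc : _root_.IsClosed (P.range : Set H) := by
    rw [LinearMap.coe_range]
    exact hanti.isClosed_range hPc
  have : CompleteSpace P.range := hrc.completeSpace_coe
  have hrange : P.range = ⊤ := by
    rw [← Submodule.orthogonal_eq_bot_iff, Submodule.eq_bot_iff]
    intro y hy
    have h1 : (y, (0 : H)) ∈ A.op.graph := by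
      rw [← LinearPMap.isSelfAdjoint_def.1 A.isSelfAdjoint,
        LinearPMap.adjoint_graph_eq_graph_adjoint A.isSelfAdjoint.dense_domain,
        Submodule.mem_adjoint_iff]
      intro a b hab
      have : inner ℝ b y = 0 := hy b ⟨⟨(a, b), hab⟩, rfl⟩
      simp [this]
    have := hb' y 0 h1
    simpa using this
  have hsurj : ∀ y : H, ∃ x : H, (x, y) ∈ A.op.graph := by
    intro y
    have : y ∈ P.range := by rw [hrange]; trivial
    obtain ⟨⟨⟨x, y'⟩, hp⟩, rfl⟩ := this
    exact ⟨x, hp⟩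
  have huniq : ∀ x x' y : H, (x, y) ∈ A.op.graph → (x', y) ∈ A.op.graph → x = x' := by
    intro x x' y h h'
    have h1 : (x - x', (0 : H)) ∈ A.op.graph := by
      simpa using A.op.graph.sub_mem h h'
    have := hb' _ _ h1
    simpa [sub_eq_zero] using this
  choose g hg using hsurj
  let G₀ : H →ₗ[ℝ] H :=
    { toFun := g
      map_add' := fun y y' => huniq _ _ _ (hg _) (A.op.graph.add_mem (hg y) (hg y'))
      map_smul' := fun a y => huniq _ _ _ (hg _) (A.op.graph.smul_mem a (hg y)) }
  let G : H →L[ℝ] H := G₀.mkContinuous c⁻¹ fun y => hb' _ _ (hg y)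
  have hG : ∀ y, G y = g y := fun _ => rfl
  refine ⟨c, hc, G, ?_, ?_, ?_⟩
  · intro x y
    constructor
    · intro h
      exact huniq _ _ _ h (hg y)
    · rintro rfl
      exact hg y
  · rw [ContinuousLinearMap.isSelfAdjoint_iff_isSymmetric]
    intro y y'
    exact (hsym _ _ _ _ (hg y) (hg y')).symm
  · intro y
    exact hb _ _ (hg y)

/-- A strictly positive self-adjoint operator has a nonnegative self-adjoint square root. -/
theorem exists_isPositiveSqrt : ∃ B : H →ₗ.[ℝ] H, IsPositiveSqrt B A.op := by
  obtain ⟨c, hc, G, hG, hGs, hGp⟩ := A.exists_inverse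
  have hR : ‖1 - c • G‖ ≤ 1 := by
    apply ContinuousLinearMap.opNorm_le_bound _ zero_le_one
    intro y
    rw [one_mul]
    apply le_of_sq_le_sq _ (norm_nonneg _)
    have h1 : (1 - c • G) y = y - c • G y := by simp
    rw [h1, norm_sub_sq_real, norm_smul, inner_smul_right, Real.norm_of_nonneg hc.le]
    nlinarith [hGp y, sq_nonneg (c * ‖G y‖)]
  have hRs : IsSelfAdjoint (1 - c • G) :=
    (IsSelfAdjoint.one _).sub (IsSelfAdjoint.smul (IsSelfAdjoint.all _) hGs)
  obtain ⟨Y, hY, hYs, hYY⟩ := exists_bounded_sqrt (1 - c • G) hR hRs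
  have hYp : ∀ y, 0 ≤ inner ℝ y ((1 - Y) y) := by
    intro y
    have h1 : inner ℝ y ((1 - Y) y) = ‖y‖ ^ 2 - inner ℝ y (Y y) := by
      simp [inner_sub_right]
    have h2 := real_inner_le_norm y (Y y)
    have h3 : ‖Y y‖ ≤ ‖y‖ := (Y.le_of_opNorm_le hY y).trans_eq (one_mul _)
    rw [h1]
    nlinarith [norm_nonneg y]
  let T : H →L[ℝ] H := (Real.sqrt c)⁻¹ • (1 - Y)
  have hTT : ∀ y, T (T y) = G y := by
    intro y
    have h1 : T * T = G := by
      simp only [T, smul_mul_smul_comm, hYY]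
      rw [← mul_inv, Real.mul_self_sqrt hc.le, sub_sub_cancel, smul_smul,
        inv_mul_cancel₀ hc.ne', one_smul]
    rw [← h1]; rfl
  have hTs : ∀ y y', inner ℝ (T y) y' = inner ℝ y (T y') := by
    have : IsSelfAdjoint T :=
      IsSelfAdjoint.smul (IsSelfAdjoint.all _) ((IsSelfAdjoint.one _).sub hYs)
    exact ContinuousLinearMap.isSelfAdjoint_iff_isSymmetric.1 this
  have hTp : ∀ y, 0 ≤ inner ℝ y (T y) := by
    intro y
    have : inner ℝ y (T y) = (Real.sqrt c)⁻¹ * inner ℝ y ((1 - Y) y) := by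
      simp only [T, smul_apply, inner_smul_right]
    rw [this]
    exact mul_nonneg (by positivity) (hYp y)
  have hTinj : ∀ y, T y = 0 → y = 0 := by
    intro y hy
    have h1 : (0 : H) = G y := by rw [← hTT, hy, map_zero]
    exact A.op.graph_fst_eq_zero_snd ((hG _ _).2 h1) rfl
  have hker : ((T : H →ₗ[ℝ] H).toPMap ⊤).toFun.ker = ⊥ := by
    rw [LinearMap.ker_eq_bot']
    intro m hm
    exact Subtype.ext (hTinj m hm)
  let B : H →ₗ.[ℝ] H := ((T : H →ₗ[ℝ] H).toPMap ⊤).inverse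
  have hB : ∀ x z : H, (x, z) ∈ B.graph ↔ x = T z := by
    intro x z
    rw [LinearPMap.inverse_graph hker, Submodule.mem_map]
    constructor
    · rintro ⟨⟨a, b⟩, hab, h⟩
      obtain ⟨m, hm1, hm2⟩ := (LinearPMap.mem_graph_iff _).1 hab
      simp only [LinearEquiv.coe_coe, LinearEquiv.prodComm_apply, Prod.swap_prod_mk,
        Prod.mk.injEq] at h
      obtain ⟨rfl, rfl⟩ := h
      dsimp only at hm1 hm2
      rw [← hm2, ← hm1]
      rfl
    · rintro rfl
      exact ⟨(z, T z), (LinearPMap.mem_graph_iff _).2 ⟨⟨z, trivial⟩, rfl, rfl⟩, rfl⟩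
  have hdom : ∀ z, T z ∈ B.domain := fun z =>
    LinearPMap.mem_domain_iff.2 ⟨z, (hB _ _).2 rfl⟩
  have hdense : Dense (B.domain : Set H) := by
    rw [Submodule.dense_iff_topologicalClosure_eq_top,
      Submodule.topologicalClosure_eq_top_iff, Submodule.eq_bot_iff]
    intro y hy
    apply hTinj
    have := hy (T (T y)) (hdom _)
    rw [hTs] at this
    exact inner_self_eq_zero.1 this
  refine ⟨B, ?_, ?_, ?_⟩
  · rw [LinearPMap.isSelfAdjoint_def]
    apply LinearPMap.eq_of_eq_graph
    ext ⟨p, q⟩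
    rw [LinearPMap.adjoint_graph_eq_graph_adjoint hdense, Submodule.mem_adjoint_iff, hB]
    constructor
    · intro h
      apply ext_inner_left ℝ
      intro b
      have := h (T b) b ((hB _ _).2 rfl)
      rw [← hTs]
      exact sub_eq_zero.1 this
    · rintro rfl a b hab
      rw [(hB _ _).1 hab, hTs, sub_self]
  · intro x
    have h := (hB _ _).1 (B.mem_graph x)
    rw [h]
    exact hTp _
  · intro x y
    simp only [hB, hG, ← hTT]
    constructor
    · rintro rfl
      exact ⟨T y, rfl, rfl⟩
    · rintro ⟨z, rfl, rfl⟩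
      rfl

end StrictlyPositiveOperator

end SquareRoot

namespace StrictlyPositiveOperator

variable {H : Type*} [NormedAddCommGroup H] [InnerProductSpace ℝ H] [CompleteSpace H]
variable (A : StrictlyPositiveOperator H)

/-- `A^{1/2}`, the nonnegative self-adjoint square root of `A`. -/
noncomputable def sqrt : H →ₗ.[ℝ] H := A.exists_isPositiveSqrt.choose

theorem isPositiveSqrt_sqrt : IsPositiveSqrt A.sqrt A.op := A.exists_isPositiveSqrt.choose_spec

theorem sqrt_injective {x : A.sqrt.domain} (hx : A.sqrt x = 0) : x = 0 := by
  have h1 : ((x : H), (0 : H)) ∈ A.sqrt.graph := by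
    have := A.sqrt.mem_graph x
    rwa [hx] at this
  have h2 : ((x : H), (0 : H)) ∈ A.op.graph :=
    (A.isPositiveSqrt_sqrt.mem_graph_iff _ _).2 ⟨0, h1, Submodule.zero_mem _⟩
  obtain ⟨z, hz1, hz2⟩ := A.op.mem_graph_iff.1 h2
  obtain ⟨c, hc, hA⟩ := A.exists_lower_bound
  have h3 := hA z
  dsimp only at hz1 hz2
  rw [hz1, hz2, inner_zero_left] at h3
  have h4 : ‖(x : H)‖ ^ 2 = 0 := le_antisymm (by nlinarith) (sq_nonneg _)
  exact Subtype.ext (by simpa using h4)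

/-- The space `H¹ = D(A^{1/2})`. -/
def H1 : Type _ := A.sqrt.domain

noncomputable instance : AddCommGroup A.H1 := inferInstanceAs (AddCommGroup A.sqrt.domain)

noncomputable instance : Module ℝ A.H1 := inferInstanceAs (Module ℝ A.sqrt.domain)

/-- The inclusion of `H¹` into `H`. -/
noncomputable def incl : A.H1 →ₗ[ℝ] H := A.sqrt.domain.subtype

/-- `A^{1/2}` as a linear map from `H¹` to `H`. -/
noncomputable def sqrtMap : A.H1 →ₗ[ℝ] H := A.sqrt.toFun

/-- The inner product `⟪u, v⟫₁ = ⟪A^{1/2} u, A^{1/2} v⟫` of `H¹`. -/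
@[reducible] noncomputable def h1Core : InnerProductSpace.Core ℝ A.H1 where
  inner u v := inner ℝ (A.sqrtMap u) (A.sqrtMap v)
  conj_inner_symm u v := by simp [real_inner_comm]
  re_inner_nonneg u := by simp
  add_left u v w := by simp [inner_add_left]
  smul_left u v r := by simp [inner_smul_left]
  definite u hu := A.sqrt_injective (inner_self_eq_zero.1 hu)

noncomputable instance : NormedAddCommGroup A.H1 :=
  @InnerProductSpace.Core.toNormedAddCommGroup ℝ A.H1 _ _ _ A.h1Core

noncomputable instance : InnerProductSpace ℝ A.H1 := InnerProductSpace.ofCore A.h1Core.toCore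

/-- The phase space `ℋ = H¹ × H¹ × H × H` of quadruples `(u, v, w, θ)`, with the product
topology and linear structure. -/
abbrev PhaseSpace : Type _ := A.H1 × A.H1 × H × H

/-- `U = (u, v, w, θ) ∈ C([0,∞), ℋ)` is a weak solution, with initial datum `z`, of
`u_ttt + α u_tt + β A u_t + γ A u = η A θ`,  `θ_t + κ A θ = - η A u_tt - α η A u_t`.

Here `v = u_t` and `w = u_tt`, and the two equations hold for every `t ≥ 0` when tested against
elements of `D(A)`, where the duality pairing of `A x` with `φ ∈ D(A)` is `⟪x, A φ⟫`.
Derivatives are relative to `[0,∞)`, hence one-sided at `t = 0`. -/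
structure IsWeakSolution (α β γ κ η : ℝ) (z : A.PhaseSpace) (U : C(ℝ≥0, A.PhaseSpace)) :
    Prop where
  initial : U 0 = z
  deriv_u : ∀ t : ℝ≥0,
    HasDerivWithinAt (fun s : ℝ => A.incl (U s.toNNReal).1) (A.incl (U t).2.1) (Ici 0) t
  deriv_v : ∀ t : ℝ≥0,
    HasDerivWithinAt (fun s : ℝ => A.incl (U s.toNNReal).2.1) (U t).2.2.1 (Ici 0) t
  deriv_w : ∀ (φ : A.op.domain) (t : ℝ≥0),
    HasDerivWithinAt (fun s : ℝ => inner ℝ (U s.toNNReal).2.2.1 (φ : H))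
      (-α * inner ℝ (U t).2.2.1 (φ : H) - β * inner ℝ (A.incl (U t).2.1) (A.op φ)
        - γ * inner ℝ (A.incl (U t).1) (A.op φ) + η * inner ℝ (U t).2.2.2 (A.op φ))
      (Ici 0) t
  deriv_θ : ∀ (ψ : A.op.domain) (t : ℝ≥0),
    HasDerivWithinAt (fun s : ℝ => inner ℝ (U s.toNNReal).2.2.2 (ψ : H))
      (-κ * inner ℝ (U t).2.2.2 (A.op ψ) - η * inner ℝ (U t).2.2.1 (A.op ψ)
        - α * η * inner ℝ (A.incl (U t).2.1) (A.op ψ))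
      (Ici 0) t

end StrictlyPositiveOperator

/-- A strongly continuous semigroup of bounded linear operators on `X`. -/
structure IsStronglyContinuousSemigroup {X : Type*} [NormedAddCommGroup X] [NormedSpace ℝ X]
    (S : ℝ≥0 → X →L[ℝ] X) : Prop where
  zero : S 0 = ContinuousLinearMap.id ℝ X
  add : ∀ s t : ℝ≥0, S (s + t) = (S s).comp (S t)
  continuous : ∀ x : X, Continuous fun t : ℝ≥0 => S t x

/-!
Write `T = A^{-1/2}`, a bounded positive operator, and `p = A^{1/2} u`, `q = A^{1/2} v`. Since the
elements of `D(A)` are exactly `T² y` with `y ∈ H`, the tested equations say that `T² w` and `T² θ`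
are differentiable in `H`. Let `δ = γ / β`. In the coordinates
`(√β p, √β (q + δ p), w + α T q, θ)` the formal generator is `M₀ + M₁ T⁻¹ + M₂ T⁻²` for constant
`4 × 4` matrices with `M₁` skew-symmetric and `M₂ + M₂ᵀ ≤ 0`; the quantity `γ - αβ` enters only
through the bounded term `M₀`. Replacing `T⁻¹` by `(T + ε)⁻¹`, which commutes with `T`, gives
bounded generators whose exponentials have norm at most `exp (‖M₀‖ t)`, uniformly in `ε`. After
multiplication by `T⁴`, which is injective with dense range, these generators converge in norm as
`ε → 0`. By Duhamel's formula their exponentials then converge strongly, and the limit semigroup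
gives every solution.
-/

section HalfLineDerivative

variable {E F : Type*} [NormedAddCommGroup E] [NormedSpace ℝ E]
  [NormedAddCommGroup F] [NormedSpace ℝ F]

/-- `f : [0,∞) → E` is differentiable with derivative `g`, the derivative at `0` being one-sided.
The function is extended to `ℝ` by its value at `0`; the extension is irrelevant since
derivatives are taken within `[0,∞)`. -/
def HasHalfLineDeriv (f g : ℝ≥0 → E) : Prop :=
  ∀ t : ℝ≥0, HasDerivWithinAt (fun s : ℝ => f s.toNNReal) (g t) (Ici 0) t

namespace HasHalfLineDeriv

variable {f f₁ f₂ g g₁ g₂ : ℝ≥0 → E}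

theorem add (h₁ : HasHalfLineDeriv f₁ g₁) (h₂ : HasHalfLineDeriv f₂ g₂) :
    HasHalfLineDeriv (fun t => f₁ t + f₂ t) (fun t => g₁ t + g₂ t) :=
  fun t => (h₁ t).fun_add (h₂ t)

theorem sub (h₁ : HasHalfLineDeriv f₁ g₁) (h₂ : HasHalfLineDeriv f₂ g₂) :
    HasHalfLineDeriv (fun t => f₁ t - f₂ t) (fun t => g₁ t - g₂ t) :=
  fun t => (h₁ t).fun_sub (h₂ t)

theorem add_iff_right (h₁ : HasHalfLineDeriv f₁ g₁) :
    HasHalfLineDeriv (fun t => f₁ t + f₂ t) (fun t => g₁ t + g₂ t) ↔ HasHalfLineDeriv f₂ g₂ :=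
  ⟨fun h => by simpa using h.sub h₁, h₁.add⟩

theorem const_smul (c : ℝ) (h : HasHalfLineDeriv f g) :
    HasHalfLineDeriv (fun t => c • f t) (fun t => c • g t) :=
  fun t => (h t).fun_const_smul c

theorem clm_apply (C : E →L[ℝ] F) (h : HasHalfLineDeriv f g) :
    HasHalfLineDeriv (fun t => C (f t)) (fun t => C (g t)) :=
  fun t => C.hasFDerivAt.comp_hasDerivWithinAt (t : ℝ) (h t)

theorem iff_integral [CompleteSpace E] (hg : Continuous g) :
    HasHalfLineDeriv f g ↔ ∀ t : ℝ≥0, f t = f 0 + ∫ s in (0 : ℝ)..t, g s.toNNReal := by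
  have hg' : Continuous fun s : ℝ => g s.toNNReal := hg.comp continuous_real_toNNReal
  constructor
  · intro h t
    have hderiv (s : ℝ) (hs : 0 ≤ s) :
        HasDerivWithinAt (fun r : ℝ => f r.toNNReal) (g s.toNNReal) (Ici 0) s := by
      simpa [hs] using h s.toNNReal
    have ftc := intervalIntegral.integral_eq_sub_of_hasDeriv_right_of_le t.coe_nonneg
      (fun s hs => (hderiv s hs.1).continuousWithinAt.mono Icc_subset_Ici_self)
      (fun s hs => (hderiv s hs.1.le).mono (Ioi_subset_Ici hs.1.le))
      (hg'.intervalIntegrable 0 t)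
    simp [ftc]
  · intro h t
    have hint : HasDerivAt (fun s : ℝ => ∫ r in (0 : ℝ)..s, g r.toNNReal) (g t) t := by
      simpa using hg'.integral_hasStrictDerivAt 0 (t : ℝ) |>.hasDerivAt
    have hf (s : ℝ) (hs : s ∈ Ici 0) :
        f s.toNNReal = f 0 + ∫ r in (0 : ℝ)..s, g r.toNNReal := by
      simpa [mem_Ici.1 hs] using h s.toNNReal
    exact (hint.hasDerivWithinAt.const_add (f 0)).congr hf (hf t t.coe_nonneg)

theorem of_separating [CompleteSpace E] [CompleteSpace F] {ι : Type*} {C : ι → E →L[ℝ] F}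
    (hC : ∀ x, (∀ i, C i x = 0) → x = 0) (hg : Continuous g)
    (h : ∀ i, HasHalfLineDeriv (fun t => C i (f t)) (fun t => C i (g t))) :
    HasHalfLineDeriv f g := by
  refine (iff_integral hg).2 fun t => sub_eq_zero.1 (hC _ fun i => ?_)
  have hi : C i (f t) = C i (f 0) + ∫ s in (0 : ℝ)..t, C i (g s.toNNReal) :=
    (iff_integral ((C i).continuous.comp hg)).1 (h i) t
  have hint : IntervalIntegrable (fun s : ℝ => g s.toNNReal) MeasureTheory.volume 0 t :=
    (hg.comp continuous_real_toNNReal).intervalIntegrable 0 t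
  rw [map_sub, map_add, sub_eq_zero, hi, (C i).intervalIntegral_comp_comm hint]

theorem clm_apply_iff [CompleteSpace E] [CompleteSpace F] {C : E →L[ℝ] F}
    (hC : Function.Injective C) (hg : Continuous g) :
    HasHalfLineDeriv (fun t => C (f t)) (fun t => C (g t)) ↔ HasHalfLineDeriv f g :=
  ⟨fun h => of_separating (C := fun _ : Unit => C)
    (fun _ hx => hC ((hx ()).trans (map_zero C).symm)) hg fun _ => h, clm_apply C⟩

theorem of_tendsto [CompleteSpace E] {f g : ℕ → ℝ≥0 → E} {f₀ g₀ : ℝ≥0 → E}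
    (h : ∀ n, HasHalfLineDeriv (f n) (g n)) (hg : ∀ n, Continuous (g n)) (hg₀ : Continuous g₀)
    (hbound : ∀ τ : ℝ≥0, ∃ C : ℝ, ∀ n, ∀ t ≤ τ, ‖g n t‖ ≤ C)
    (hf_lim : ∀ t, Tendsto (fun n => f n t) atTop (𝓝 (f₀ t)))
    (hg_lim : ∀ t, Tendsto (fun n => g n t) atTop (𝓝 (g₀ t))) : HasHalfLineDeriv f₀ g₀ := by
  refine (iff_integral hg₀).2 fun τ => ?_
  obtain ⟨C, hC⟩ := hbound τ
  have hint : Tendsto (fun n => ∫ s in (0 : ℝ)..τ, g n s.toNNReal) atTop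
      (𝓝 (∫ s in (0 : ℝ)..τ, g₀ s.toNNReal)) := by
    refine intervalIntegral.tendsto_integral_filter_of_dominated_convergence (fun _ => C)
      (.of_forall fun n => ((hg n).comp continuous_real_toNNReal).aestronglyMeasurable)
      (.of_forall fun n => .of_forall fun s hs => hC n _ ?_) intervalIntegrable_const
      (.of_forall fun s _ => hg_lim _)
    rw [uIoc_of_le τ.coe_nonneg] at hs
    exact Real.toNNReal_le_iff_le_coe.2 hs.2
  refine tendsto_nhds_unique (hf_lim τ) (((hf_lim 0).add hint).congr fun n => ?_)
  exact ((iff_integral (hg n)).1 (h n) τ).symm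

theorem piLp_iff {ι : Type*} [Fintype ι] {f g : ℝ≥0 → PiLp 2 (fun _ : ι => E)} :
    HasHalfLineDeriv f g ↔ ∀ i, HasHalfLineDeriv (fun t => f t i) (fun t => g t i) := by
  refine ⟨fun h i => h.clm_apply (PiLp.proj 2 (fun _ : ι => E) i), fun h t => ?_⟩
  have hpi : HasDerivWithinAt (fun (s : ℝ) i => f s.toNNReal i) (fun i => g t i) (Ici 0) t :=
    hasDerivWithinAt_pi.2 fun i => h i t
  exact (PiLp.continuousLinearEquiv 2 ℝ (fun _ : ι => E)).symm.hasFDerivAt.comp_hasDerivWithinAt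
    (t : ℝ) hpi

end HasHalfLineDeriv

end HalfLineDerivative

section ExponentialApproximation

variable {X Y : Type*} [NormedAddCommGroup X] [NormedSpace ℝ X]
  [NormedAddCommGroup Y] [NormedSpace ℝ Y]

/-- The group `(exp (t L))_{t ∈ ℝ}` generated by a bounded operator `L`. -/
noncomputable def expGroup (L : X →L[ℝ] X) (t : ℝ) : X →L[ℝ] X := NormedSpace.exp (t • L)

theorem expGroup_zero (L : X →L[ℝ] X) : expGroup L 0 = 1 := by
  simp [expGroup, NormedSpace.exp_zero]

theorem commute_expGroup {J L : X →L[ℝ] X} (h : Commute J L) (t : ℝ) :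
    Commute J (expGroup L t) :=
  (h.smul_right t).exp_right

section Complete

variable [CompleteSpace X]

theorem expGroup_add (L : X →L[ℝ] X) (s t : ℝ) :
    expGroup L (s + t) = expGroup L s * expGroup L t := by
  let _ : NormedAlgebra ℚ (X →L[ℝ] X) := NormedAlgebra.restrictScalars ℚ ℝ _
  rw [expGroup, add_smul]
  exact NormedSpace.exp_add_of_commute (((Commute.refl L).smul_left s).smul_right t)

theorem hasDerivAt_expGroup (L : X →L[ℝ] X) (t : ℝ) :
    HasDerivAt (expGroup L) (expGroup L t * L) t :=
  hasDerivAt_exp_smul_const (𝕂 := ℝ) L t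

theorem hasDerivAt_expGroup_apply (L : X →L[ℝ] X) (x : X) (t : ℝ) :
    HasDerivAt (fun s => expGroup L s x) (expGroup L t (L x)) t := by
  simpa using (hasDerivAt_expGroup L t).clm_apply (hasDerivAt_const t x)

theorem continuous_expGroup_apply (L : X →L[ℝ] X) (x : X) :
    Continuous fun t => expGroup L t x :=
  continuous_iff_continuousAt.2 fun t => (hasDerivAt_expGroup_apply L x t).continuousAt

theorem hasHalfLineDeriv_expGroup_apply (L : X →L[ℝ] X) (x : X) :
    HasHalfLineDeriv (fun t => expGroup L t x) (fun t => expGroup L t (L x)) := by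
  intro t
  refine (hasDerivAt_expGroup_apply L x t).hasDerivWithinAt.congr (fun s hs => ?_) ?_
  · simp only [Real.coe_toNNReal s hs]
  · simp only [Real.toNNReal_coe]

/-- The derivative of `s ↦ exp ((t - s) L) (J y(s))` is `exp ((t - s) L) ((K - L J) y(s))`. -/
theorem norm_sub_expGroup_le {L J K : X →L[ℝ] X} {y : ℝ≥0 → X}
    (hy : HasHalfLineDeriv (fun t => J (y t)) (fun t => K (y t))) {t : ℝ≥0} {C D : ℝ}
    (hC : ∀ s ∈ Icc 0 (t : ℝ), ‖expGroup L s‖ ≤ C) (hD : ∀ s ≤ t, ‖y s‖ ≤ D) :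
    ‖J (y t) - expGroup L t (J (y 0))‖ ≤ C * (‖K - L * J‖ * D) * t := by
  have hC0 : 0 ≤ C := (norm_nonneg _).trans (hC 0 ⟨le_rfl, t.coe_nonneg⟩)
  have hderiv (s : ℝ) (hs : s ∈ Icc 0 (t : ℝ)) :
      HasDerivWithinAt (fun s => expGroup L (t - s) (J (y s.toNNReal)))
        (expGroup L (t - s) ((K - L * J) (y s.toNNReal))) (Icc 0 (t : ℝ)) s := by
    have hexp : HasDerivAt (fun s => expGroup L (t - s)) (-(expGroup L (t - s) * L)) s := by
      simpa [Function.comp_def] using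
        (hasDerivAt_expGroup L (t - s)).scomp s ((hasDerivAt_id s).const_sub (t : ℝ))
    have hys := hy s.toNNReal
    rw [Real.coe_toNNReal s hs.1] at hys
    convert hexp.hasDerivWithinAt.clm_apply (hys.mono Icc_subset_Ici_self) using 1
    simp only [sub_apply, mul_apply_eq_comp, map_sub, neg_apply]
    abel
  have hle (s : ℝ) (hs : s ∈ Ico 0 (t : ℝ)) :
      ‖expGroup L (t - s) ((K - L * J) (y s.toNNReal))‖ ≤ C * (‖K - L * J‖ * D) := by
    have hexp : ‖expGroup L (t - s)‖ ≤ C := hC _ ⟨by linarith [hs.2], by linarith [hs.1]⟩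
    have hys : ‖y s.toNNReal‖ ≤ D := hD _ (Real.toNNReal_le_iff_le_coe.2 hs.2.le)
    exact (ContinuousLinearMap.le_of_opNorm_le _ hexp _).trans
      (mul_le_mul_of_nonneg_left (ContinuousLinearMap.le_opNorm_of_le _ hys) hC0)
  simpa [expGroup_zero] using norm_image_sub_le_of_norm_deriv_le_segment' hderiv hle t
    ⟨t.coe_nonneg, le_rfl⟩

end Complete

theorem tendsto_clm_apply [CompleteSpace X] {T : ℕ → X →L[ℝ] Y} {T₀ : X →L[ℝ] Y}
    (hT : ∀ x, Tendsto (fun n => T n x) atTop (𝓝 (T₀ x))) {x : ℕ → X} {x₀ : X}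
    (hx : Tendsto x atTop (𝓝 x₀)) : Tendsto (fun n => T n (x n)) atTop (𝓝 (T₀ x₀)) := by
  obtain ⟨C, hC⟩ : ∃ C, ∀ n, ‖T n‖ ≤ C := by
    refine banach_steinhaus fun x => ?_
    obtain ⟨C, hC⟩ := (Metric.isBounded_range_of_tendsto _ (hT x)).exists_norm_le
    exact ⟨C, fun n => hC _ (mem_range_self n)⟩
  have hdiff : Tendsto (fun n => T n (x n - x₀)) atTop (𝓝 0) := by
    refine squeeze_zero_norm (fun n => (T n).le_of_opNorm_le (hC n) (x n - x₀)) ?_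
    simpa using (tendsto_iff_norm_sub_tendsto_zero.1 hx).const_mul C
  simpa using hdiff.add (hT x₀)

theorem uniformCauchySeqOn_of_denseRange {ι Z : Type*} {T : ℕ → ι → X →L[ℝ] Y} {s : Set ι}
    {C : ℝ} (hC : ∀ n, ∀ i ∈ s, ‖T n i‖ ≤ C) {J : Z → X} (hJ : DenseRange J)
    (h : ∀ z, UniformCauchySeqOn (fun n i => T n i (J z)) atTop s) (x : X) :
    UniformCauchySeqOn (fun n i => T n i x) atTop s := by
  rw [Metric.uniformCauchySeqOn_iff]
  intro ε hε
  obtain ⟨z, hz⟩ := hJ.exists_dist_lt x (ε := ε / (3 * (|C| + 1))) (by positivity)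
  obtain ⟨N, hN⟩ := Metric.uniformCauchySeqOn_iff.1 (h z) (ε / 3) (by positivity)
  have hclose (n : ℕ) (i : ι) (hi : i ∈ s) : dist (T n i x) (T n i (J z)) < ε / 3 := by
    calc dist (T n i x) (T n i (J z)) = ‖T n i (x - J z)‖ := by rw [dist_eq_norm, map_sub]
      _ ≤ (|C| + 1) * dist x (J z) := by
        rw [dist_eq_norm]
        exact (T n i).le_of_opNorm_le (by linarith [hC n i hi, le_abs_self C]) _
      _ < (|C| + 1) * (ε / (3 * (|C| + 1))) := by gcongr
      _ = ε / 3 := by field_simp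
  refine ⟨N, fun m hm n hn i hi => ?_⟩
  calc dist (T m i x) (T n i x)
      ≤ dist (T m i x) (T m i (J z)) + dist (T m i (J z)) (T n i (J z)) +
        dist (T n i (J z)) (T n i x) := dist_triangle4 _ _ _ _
    _ < ε / 3 + ε / 3 + ε / 3 := by
      gcongr
      · exact hclose m i hi
      · exact hN m hm n hn i hi
      · exact (dist_comm _ _).trans_lt (hclose n i hi)
    _ = ε := by ring

/-- `S` is the limit of the groups `exp (t L n)` as `n → ∞`, strongly and locally uniformly in
`t ∈ [0,∞)`. -/
def IsExpLimit (L : ℕ → X →L[ℝ] X) (S : ℝ≥0 → X →L[ℝ] X) : Prop :=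
  ∀ x, TendstoLocallyUniformly (fun n (t : ℝ≥0) => expGroup (L n) t x) (fun t => S t x) atTop

namespace IsExpLimit

variable {L : ℕ → X →L[ℝ] X} {S : ℝ≥0 → X →L[ℝ] X}

theorem tendsto_apply (h : IsExpLimit L S) (t : ℝ≥0) (x : X) :
    Tendsto (fun n => expGroup (L n) t x) atTop (𝓝 (S t x)) :=
  (tendstoLocallyUniformlyOn_univ.2 (h x)).tendsto_at (mem_univ t)

theorem isStronglyContinuousSemigroup [CompleteSpace X] (h : IsExpLimit L S) :
    IsStronglyContinuousSemigroup S where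
  zero := ContinuousLinearMap.ext fun x =>
    tendsto_nhds_unique (h.tendsto_apply 0 x) (by simp [expGroup_zero])
  add s t := ContinuousLinearMap.ext fun x => by
    refine tendsto_nhds_unique (h.tendsto_apply (s + t) x) ?_
    refine (tendsto_clm_apply (h.tendsto_apply s) (h.tendsto_apply t x)).congr fun n => ?_
    rw [NNReal.coe_add, expGroup_add, mul_apply_eq_comp]
  continuous x := (h x).continuous <| .of_forall fun n =>
    (continuous_expGroup_apply (L n) x).comp NNReal.continuous_coe

end IsExpLimit

/-- Bounded operators `L n` approximating the formal generator `K J⁻¹`: they commute with `J`,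
the groups `exp (t L n)` are bounded uniformly in `n` for `t` in bounded subsets of `[0,∞)`, and
`L n J → K`. -/
structure IsStableApproximation (L : ℕ → X →L[ℝ] X) (J K : X →L[ℝ] X) : Prop where
  exists_bound : ∀ τ : ℝ≥0, ∃ C : ℝ, ∀ n, ∀ t ∈ Icc 0 (τ : ℝ), ‖expGroup (L n) t‖ ≤ C
  commute : ∀ n, Commute J (L n)
  tendsto : Tendsto (fun n => L n * J) atTop (𝓝 K)

namespace IsStableApproximation

variable {L : ℕ → X →L[ℝ] X} {J K : X →L[ℝ] X}

theorem apply_expGroup (h : IsStableApproximation L J K) (n : ℕ) (t : ℝ) (x : X) :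
    J (expGroup (L n) t x) = expGroup (L n) t (J x) :=
  DFunLike.congr_fun (commute_expGroup (h.commute n) t).eq x

variable [CompleteSpace X]

theorem hasHalfLineDeriv_expGroup (h : IsStableApproximation L J K) (n : ℕ) (x : X) :
    HasHalfLineDeriv (fun t => J (expGroup (L n) t x))
      (fun t => (L n * J) (expGroup (L n) t x)) := by
  have hL (t : ℝ) : (L n * J) (expGroup (L n) t x) = expGroup (L n) t (L n (J x)) := by
    rw [mul_apply_eq_comp, h.apply_expGroup]
    exact DFunLike.congr_fun (commute_expGroup (Commute.refl (L n)) t).eq (J x)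
  simpa only [hL, h.apply_expGroup] using hasHalfLineDeriv_expGroup_apply (L n) (J x)

theorem uniformCauchySeqOn_apply (h : IsStableApproximation L J K) (τ : ℝ≥0) (x : X) :
    UniformCauchySeqOn (fun n (t : ℝ≥0) => expGroup (L n) t (J x)) atTop (Iic τ) := by
  obtain ⟨C, hC⟩ := h.exists_bound τ
  have hC0 : 0 ≤ C := (norm_nonneg _).trans (hC 0 0 ⟨le_rfl, τ.coe_nonneg⟩)
  have hle (m n : ℕ) (t : ℝ≥0) (ht : t ≤ τ) :
      ‖expGroup (L m) t (J x) - expGroup (L n) t (J x)‖ ≤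
        C * (‖L m * J - L n * J‖ * (C * ‖x‖)) * τ := by
    have hcomp := norm_sub_expGroup_le (h.hasHalfLineDeriv_expGroup m x) (L := L n) (t := t)
      (fun s hs => hC n s ⟨hs.1, hs.2.trans ht⟩)
      (fun s hs => (expGroup (L m) s).le_of_opNorm_le (hC m s ⟨s.2, hs.trans ht⟩) x)
    rw [h.apply_expGroup, NNReal.coe_zero, expGroup_zero, one_apply_eq_self] at hcomp
    exact hcomp.trans (by gcongr)
  rw [Metric.uniformCauchySeqOn_iff]
  intro ε hε
  obtain ⟨N, hN⟩ := Metric.cauchySeq_iff.1 h.tendsto.cauchySeq (ε / (C * (C * ‖x‖) * τ + 1))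
    (by positivity)
  refine ⟨N, fun m hm n hn t ht => ?_⟩
  have hmn := hN m hm n hn
  rw [dist_eq_norm, lt_div_iff₀ (by positivity)] at hmn
  rw [dist_eq_norm]
  linarith [hle m n t ht, norm_nonneg (L m * J - L n * J)]

theorem exists_isExpLimit (h : IsStableApproximation L J K) (hJ : DenseRange J) :
    ∃ S, IsExpLimit L S := by
  have hcauchy (τ : ℝ≥0) (x : X) :
      UniformCauchySeqOn (fun n (t : ℝ≥0) => expGroup (L n) t x) atTop (Iic τ) := by
    obtain ⟨C, hC⟩ := h.exists_bound τ
    exact uniformCauchySeqOn_of_denseRange (T := fun n (t : ℝ≥0) => expGroup (L n) t)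
      (fun n t ht => hC n t ⟨t.2, ht⟩) hJ (h.uniformCauchySeqOn_apply τ) x
  choose f hf using fun (t : ℝ≥0) (x : X) =>
    cauchySeq_tendsto_of_complete ((hcauchy t x).cauchySeq self_mem_Iic)
  refine ⟨fun t => continuousLinearMapOfTendsto _ (tendsto_pi_nhds.2 (hf t)), fun x => ?_⟩
  rw [tendstoLocallyUniformly_iff_forall_isCompact]
  intro s hs
  obtain ⟨τ, hτ⟩ := hs.bddAbove
  exact ((hcauchy τ x).mono hτ).tendstoUniformlyOn_of_tendsto fun t _ => hf t x

variable {S : ℝ≥0 → X →L[ℝ] X}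

theorem hasHalfLineDeriv_limit (h : IsStableApproximation L J K) (hS : IsExpLimit L S) (x : X) :
    HasHalfLineDeriv (fun t => J (S t x)) (fun t => K (S t x)) := by
  obtain ⟨D, hD⟩ := (Metric.isBounded_range_of_tendsto _ h.tendsto).exists_norm_le
  refine .of_tendsto (fun n => h.hasHalfLineDeriv_expGroup n x) (fun n => ?_) ?_ (fun τ => ?_)
    (fun t => (J.continuous.tendsto _).comp (hS.tendsto_apply t x)) (fun t => ?_)
  · exact (L n * J).continuous.comp
      ((continuous_expGroup_apply (L n) x).comp NNReal.continuous_coe)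
  · exact K.continuous.comp (hS.isStronglyContinuousSemigroup.continuous x)
  · obtain ⟨C, hC⟩ := h.exists_bound τ
    refine ⟨D * (C * ‖x‖), fun n t ht => ?_⟩
    have hexp := (expGroup (L n) t).le_of_opNorm_le (hC n t ⟨t.2, ht⟩) x
    exact ContinuousLinearMap.le_of_opNorm_le_of_le _ (hD _ (mem_range_self n)) hexp
  · exact tendsto_clm_apply (fun y => ((continuous_eval_const y).tendsto K).comp h.tendsto)
      (hS.tendsto_apply t x)

theorem eq_limit (h : IsStableApproximation L J K) (hJ : Function.Injective J)
    (hS : IsExpLimit L S) {y : ℝ≥0 → X} (hy : Continuous y)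
    (hderiv : HasHalfLineDeriv (fun t => J (y t)) (fun t => K (y t))) (t : ℝ≥0) :
    y t = S t (y 0) := by
  obtain ⟨C, hC⟩ := h.exists_bound t
  obtain ⟨D, hD⟩ := (isCompact_Icc (a := 0) (b := t)).exists_bound_of_continuousOn hy.continuousOn
  have hle (n : ℕ) := norm_sub_expGroup_le hderiv (hC n) fun s hs => hD s ⟨zero_le, hs⟩
  have hbound : Tendsto (fun n => C * (‖K - L n * J‖ * D) * t) atTop (𝓝 0) := by
    have hK : Tendsto (fun n => ‖K - L n * J‖) atTop (𝓝 0) := by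
      simpa using (h.tendsto.const_sub K).norm
    simpa using ((hK.mul_const D).const_mul C).mul_const (t : ℝ)
  have hlim : Tendsto (fun n => J (y t) - expGroup (L n) t (J (y 0))) atTop
      (𝓝 (J (y t) - J (S t (y 0)))) := by
    simpa only [Function.comp_def, h.apply_expGroup] using
      ((J.continuous.tendsto _).comp (hS.tendsto_apply t (y 0))).const_sub (J (y t))
  exact hJ (sub_eq_zero.1 (tendsto_nhds_unique hlim (squeeze_zero_norm hle hbound)))

theorem exists_semigroup (h : IsStableApproximation L J K) (hdense : DenseRange J)
    (hinj : Function.Injective J) :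
    ∃ S : ℝ≥0 → X →L[ℝ] X, IsStronglyContinuousSemigroup S ∧ ∀ y : C(ℝ≥0, X),
      HasHalfLineDeriv (fun t => J (y t)) (fun t => K (y t)) ↔ ∀ t, y t = S t (y 0) := by
  obtain ⟨S, hS⟩ := h.exists_isExpLimit hdense
  refine ⟨S, hS.isStronglyContinuousSemigroup, fun y => ⟨h.eq_limit hinj hS y.continuous, ?_⟩⟩
  intro hy
  have hy' : ⇑y = fun t => S t (y 0) := funext hy
  rw [hy']
  exact h.hasHalfLineDeriv_limit hS (y 0)

end IsStableApproximation

end ExponentialApproximation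

section RegularizedInverse

variable {E : Type*} [NormedAddCommGroup E] [NormedSpace ℝ E]

/-- `(T + ε)⁻¹`, a bounded substitute for the possibly unbounded inverse of a positive
operator `T`. -/
noncomputable def regularizedInverse (T : E →L[ℝ] E) (ε : ℝ) : E →L[ℝ] E :=
  Ring.inverse (T + ε • 1)

theorem commute_regularizedInverse {M T : E →L[ℝ] E} (h : Commute M T) (ε : ℝ) :
    Commute M (regularizedInverse T ε) := by
  have hM : Commute M (T + ε • 1) := h.add_right ((Commute.one_right M).smul_right ε)
  rw [regularizedInverse]
  by_cases hunit : IsUnit (T + ε • 1)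
  · obtain ⟨u, hu⟩ := hunit
    rw [← hu, Ring.inverse_unit]
    exact Commute.units_inv_right (hu ▸ hM)
  · rw [Ring.inverse_non_unit _ hunit]
    exact Commute.zero_right M

variable {X : Type*} [NormedAddCommGroup X] [InnerProductSpace ℝ X] [CompleteSpace X]

theorem isSelfAdjoint_regularizedInverse {T : X →L[ℝ] X} (hT : IsSelfAdjoint T) (ε : ℝ) :
    IsSelfAdjoint (regularizedInverse T ε) :=
  (hT.add (.smul (.all ε) (.one _))).ringInverse

theorem isUnit_add_smul_one {T : X →L[ℝ] X} (hT : T.IsPositive) {ε : ℝ} (hε : 0 < ε) :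
    IsUnit (T + ε • 1) := by
  refine ContinuousLinearMap.isUnit_of_forall_le_norm_inner_map _ (c := ⟨ε, hε.le⟩) hε fun x => ?_
  have hinner : inner ℝ ((T + ε • 1) x) x = inner ℝ (T x) x + ε * ‖x‖ ^ 2 := by
    simp [inner_add_left, inner_smul_left]
  calc ‖x‖ ^ 2 * ε ≤ inner ℝ ((T + ε • 1) x) x := by
        linarith [hT.inner_nonneg_left x]
    _ ≤ ‖inner ℝ ((T + ε • 1) x) x‖ := le_abs_self _

theorem norm_mul_regularizedInverse_le_one {T : X →L[ℝ] X} (hT : T.IsPositive) {ε : ℝ}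
    (hε : 0 < ε) : ‖T * regularizedInverse T ε‖ ≤ 1 := by
  refine ContinuousLinearMap.opNorm_le_bound _ zero_le_one fun x => ?_
  set y := regularizedInverse T ε x with hy
  have hx : T y + ε • y = x := by
    simpa [hy, regularizedInverse] using
      DFunLike.congr_fun (Ring.mul_inverse_cancel _ (isUnit_add_smul_one hT hε)) x
  have hsq : ‖T y‖ ^ 2 ≤ ‖x‖ ^ 2 := by
    rw [← hx, norm_add_sq_real, inner_smul_right]
    nlinarith [mul_nonneg hε.le (hT.inner_nonneg_left y), sq_nonneg ‖ε • y‖]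
  simpa using le_of_sq_le_sq hsq (norm_nonneg x)

theorem norm_regularizedInverse_mul_sq_sub_le {T : X →L[ℝ] X} (hT : T.IsPositive) {ε : ℝ}
    (hε : 0 < ε) : ‖regularizedInverse T ε * T ^ 2 - T‖ ≤ ε := by
  set B := regularizedInverse T ε
  have hB : B * T = T * B := (commute_regularizedInverse (Commute.refl T) ε).eq.symm
  have hcancel : (T + ε • 1) * B = 1 := Ring.mul_inverse_cancel _ (isUnit_add_smul_one hT hε)
  have hdiff : B * T ^ 2 - T = -(ε • (T * B)) := by
    calc B * T ^ 2 - T = T * (T * B) - T * ((T + ε • 1) * B) := by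
          rw [hcancel, mul_one, pow_two, ← mul_assoc, hB, mul_assoc, hB]
      _ = -(ε • (T * B)) := by simp [add_mul, mul_add]
  rw [hdiff, norm_neg, norm_smul, Real.norm_of_nonneg hε.le]
  exact mul_le_of_le_one_right hε.le (norm_mul_regularizedInverse_le_one hT hε)

theorem tendsto_regularizedInverse_mul_sq {T : X →L[ℝ] X} (hT : T.IsPositive) :
    Tendsto (fun n : ℕ => regularizedInverse T (1 / (n + 1)) * T ^ 2) atTop (𝓝 T) :=
  tendsto_iff_norm_sub_tendsto_zero.2 <| squeeze_zero (fun _ => norm_nonneg _)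
    (fun _ => norm_regularizedInverse_mul_sq_sub_le hT (by positivity))
    tendsto_one_div_add_atTop_nhds_zero_nat

theorem denseRange_of_isSelfAdjoint {J : X →L[ℝ] X} (hJ : IsSelfAdjoint J)
    (hinj : Function.Injective J) : DenseRange J := by
  have hbot : J.rangeᗮ = ⊥ := by
    rw [J.orthogonal_range, hJ.adjoint_eq, LinearMap.ker_eq_bot]
    exact hinj
  have hdense : Dense (J.range : Set X) := Submodule.dense_iff_topologicalClosure_eq_top.2
    (Submodule.topologicalClosure_eq_top_iff.2 hbot)
  rwa [LinearMap.coe_range] at hdense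

end RegularizedInverse

section SecondOrderGeneration

variable {X : Type*} [NormedAddCommGroup X] [InnerProductSpace ℝ X] [CompleteSpace X]

theorem norm_expGroup_le {L : X →L[ℝ] X} {ω : ℝ} (hL : ∀ x, inner ℝ (L x) x ≤ ω * ‖x‖ ^ 2)
    {t : ℝ} (ht : 0 ≤ t) : ‖expGroup L t‖ ≤ Real.exp (ω * t) := by
  refine ContinuousLinearMap.opNorm_le_bound _ (Real.exp_pos _).le fun x => ?_
  have hL_expGroup (s : ℝ) : expGroup L s (L x) = L (expGroup L s x) :=
    DFunLike.congr_fun (commute_expGroup (Commute.refl L) s).eq.symm x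
  have hderiv (s : ℝ) : HasDerivAt (fun s => Real.exp (-(2 * ω) * s) * ‖expGroup L s x‖ ^ 2)
      (2 * Real.exp (-(2 * ω) * s) *
        (inner ℝ (L (expGroup L s x)) (expGroup L s x) - ω * ‖expGroup L s x‖ ^ 2)) s := by
    refine (((hasDerivAt_id s).const_mul (-(2 * ω))).exp.mul
      (hasDerivAt_expGroup_apply L x s).norm_sq).congr_deriv ?_
    rw [hL_expGroup, real_inner_comm]
    simp only [id]
    ring
  have hanti : Antitone fun s => Real.exp (-(2 * ω) * s) * ‖expGroup L s x‖ ^ 2 :=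
    antitone_of_hasDerivAt_nonpos hderiv fun s =>
      mul_nonpos_of_nonneg_of_nonpos (by positivity) (sub_nonpos.2 (hL _))
  have hsq : Real.exp (-(2 * ω) * t) * ‖expGroup L t x‖ ^ 2 ≤ ‖x‖ ^ 2 := by
    simpa [expGroup_zero] using hanti ht
  refine le_of_sq_le_sq ?_ (by positivity)
  calc ‖expGroup L t x‖ ^ 2
      = Real.exp (2 * ω * t) * (Real.exp (-(2 * ω) * t) * ‖expGroup L t x‖ ^ 2) := by
        rw [← mul_assoc, ← Real.exp_add]
        simp
    _ ≤ Real.exp (2 * ω * t) * ‖x‖ ^ 2 := by gcongr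
    _ = (Real.exp (ω * t) * ‖x‖) ^ 2 := by
        rw [mul_pow, ← Real.exp_nat_mul]
        congr 2
        push_cast
        ring

theorem inner_apply_self_eq_zero_of_mem_skewAdjoint {L : X →L[ℝ] X}
    (hL : L ∈ skewAdjoint (X →L[ℝ] X)) (x : X) : inner ℝ (L x) x = 0 := by
  have hadj : L.adjoint = -L := skewAdjoint.mem_iff.1 hL
  have hneg : inner ℝ (L x) x = -inner ℝ (L x) x := by
    conv_lhs => rw [← L.adjoint_inner_right, hadj, neg_apply, inner_neg_right, real_inner_comm]
  linarith

theorem inner_quadratic_le {M₀ M₁ M₂ B : X →L[ℝ] X} (hskew : M₁ ∈ skewAdjoint (X →L[ℝ] X))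
    (hdiss : ∀ x, inner ℝ (M₂ x) x ≤ 0) (hB : IsSelfAdjoint B) (h₁ : Commute M₁ B)
    (h₂ : Commute M₂ B) (x : X) :
    inner ℝ ((M₀ + M₁ * B + M₂ * B ^ 2) x) x ≤ ‖M₀‖ * ‖x‖ ^ 2 := by
  have hM₁ : inner ℝ ((M₁ * B) x) x = 0 := by
    refine inner_apply_self_eq_zero_of_mem_skewAdjoint ?_ x
    rw [skewAdjoint.mem_iff, star_mul, hB.star_eq, skewAdjoint.mem_iff.1 hskew, mul_neg, h₁.eq]
  have hM₂ : inner ℝ ((M₂ * B ^ 2) x) x ≤ 0 := by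
    have hB' : (M₂ * B ^ 2) x = B (M₂ (B x)) := by
      rw [pow_two, ← mul_assoc, h₂.eq]
      rfl
    rw [hB', ← B.adjoint_inner_right, hB.adjoint_eq]
    exact hdiss (B x)
  have hM₀ : inner ℝ (M₀ x) x ≤ ‖M₀‖ * ‖x‖ ^ 2 := by
    rw [pow_two, ← mul_assoc]
    exact (real_inner_le_norm _ _).trans (by gcongr; exact M₀.le_opNorm x)
  simp only [add_apply, inner_add_left]
  linarith

variable {T M₀ M₁ M₂ : X →L[ℝ] X}

/-- The norm convergence `(T + ε)⁻¹ T² → T` costs a factor `T²` in the denominator of the formal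
generator `M₀ + M₁ T⁻¹ + M₂ T⁻²`, which is therefore written over `T⁴`. -/
theorem isStableApproximation_quadratic (hT : T.IsPositive) (h₀ : Commute T M₀)
    (h₁ : Commute T M₁) (h₂ : Commute T M₂) (hskew : M₁ ∈ skewAdjoint (X →L[ℝ] X))
    (hdiss : ∀ x, inner ℝ (M₂ x) x ≤ 0) :
    IsStableApproximation
      (fun n : ℕ => M₀ + M₁ * regularizedInverse T (1 / (n + 1)) +
        M₂ * regularizedInverse T (1 / (n + 1)) ^ 2)
      (T ^ 4) (T ^ 2 * (M₀ * T ^ 2 + M₁ * T + M₂)) where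
  exists_bound τ := by
    refine ⟨Real.exp (‖M₀‖ * τ), fun n t ht => ?_⟩
    have hn (M : X →L[ℝ] X) (h : Commute T M) := commute_regularizedInverse h.symm (1 / (n + 1))
    refine (norm_expGroup_le (inner_quadratic_le hskew hdiss
      (isSelfAdjoint_regularizedInverse hT.isSelfAdjoint _) (hn M₁ h₁) (hn M₂ h₂)) ht.1).trans ?_
    gcongr
    exact ht.2
  commute n := by
    have hB := commute_regularizedInverse (Commute.refl T) (1 / (n + 1))
    exact ((h₀.add_right (h₁.mul_right hB)).add_right
      (h₂.mul_right (hB.pow_right 2))).pow_left 4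
  tendsto := by
    have hlim := tendsto_regularizedInverse_mul_sq hT
    have hlim₁ := (hlim.mul_const (T ^ 2)).const_mul M₁
    have hlim₂ := (hlim.pow 2).const_mul M₂
    have hK : T ^ 2 * (M₀ * T ^ 2 + M₁ * T + M₂) =
        M₀ * T ^ 4 + M₁ * (T * T ^ 2) + M₂ * T ^ 2 := by
      rw [(((h₀.mul_right (Commute.refl T |>.pow_right 2)).add_right
        (h₁.mul_right (Commute.refl T))).add_right h₂ |>.pow_left 2).eq]
      simp only [add_mul, mul_assoc, ← pow_add]
    rw [hK]
    refine ((hlim₁.const_add (M₀ * T ^ 4)).add hlim₂).congr fun n => ?_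
    have hB := commute_regularizedInverse (Commute.refl T) (1 / (n + 1))
    rw [(hB.symm.pow_right 2).mul_pow]
    simp only [add_mul, mul_assoc, ← pow_add, ← pow_mul]

theorem exists_semigroup_quadratic (hT : T.IsPositive) (hinj : Function.Injective T)
    (h₀ : Commute T M₀) (h₁ : Commute T M₁) (h₂ : Commute T M₂)
    (hskew : M₁ ∈ skewAdjoint (X →L[ℝ] X)) (hdiss : ∀ x, inner ℝ (M₂ x) x ≤ 0) :
    ∃ S : ℝ≥0 → X →L[ℝ] X, IsStronglyContinuousSemigroup S ∧ ∀ y : C(ℝ≥0, X),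
      HasHalfLineDeriv (fun t => (T ^ 2) (y t)) (fun t => (M₀ * T ^ 2 + M₁ * T + M₂) (y t)) ↔
        ∀ t, y t = S t (y 0) := by
  have hpow (n : ℕ) : Function.Injective ⇑(T ^ n) := by
    rw [FunLike.coe_pow_eq_iterate]
    exact hinj.iterate n
  obtain ⟨S, hS, hy⟩ := (isStableApproximation_quadratic hT h₀ h₁ h₂ hskew hdiss).exists_semigroup
    (denseRange_of_isSelfAdjoint (hT.isSelfAdjoint.pow 4) (hpow 4)) (hpow 4)
  have hcont (y : C(ℝ≥0, X)) : Continuous fun t => (M₀ * T ^ 2 + M₁ * T + M₂) (y t) :=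
    (M₀ * T ^ 2 + M₁ * T + M₂).continuous.comp y.continuous
  refine ⟨S, hS, fun y => (HasHalfLineDeriv.clm_apply_iff (hpow 2) (hcont y)).symm.trans ?_⟩
  rw [← hy y]
  have hpow_four (x : X) : (T ^ 4) x = (T ^ 2) ((T ^ 2) x) := by
    rw [← mul_apply_eq_comp, ← pow_add]
  simp only [hpow_four, mul_apply_eq_comp]

end SecondOrderGeneration

section KroneckerOperator

variable {E : Type*} [NormedAddCommGroup E] [NormedSpace ℝ E]
variable {ι : Type*} [Fintype ι]

/-- The operator `M ⊗ C` on `E ^ ι = ℝ ^ ι ⊗ E`, which carries the `ℓ²` norm. -/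
noncomputable def kroneckerOperator (M : Matrix ι ι ℝ) (C : E →L[ℝ] E) :
    PiLp 2 (fun _ : ι => E) →L[ℝ] PiLp 2 (fun _ : ι => E) :=
  (PiLp.continuousLinearEquiv 2 ℝ (fun _ : ι => E)).symm.toContinuousLinearMap ∘L
    ContinuousLinearMap.pi fun i => ∑ j, M i j • C ∘L PiLp.proj 2 (fun _ : ι => E) j

theorem kroneckerOperator_apply (M : Matrix ι ι ℝ) (C : E →L[ℝ] E) (x : PiLp 2 (fun _ : ι => E))
    (i : ι) : kroneckerOperator M C x i = ∑ j, M i j • C (x j) := by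
  simp [kroneckerOperator]

theorem kroneckerOperator_mul (M N : Matrix ι ι ℝ) (C D : E →L[ℝ] E) :
    kroneckerOperator M C * kroneckerOperator N D = kroneckerOperator (M * N) (C * D) := by
  ext x i
  simp only [mul_apply_eq_comp, kroneckerOperator_apply, map_sum, map_smul, Matrix.mul_apply,
    Finset.smul_sum, Finset.sum_smul, smul_smul]
  exact Finset.sum_comm

theorem kroneckerOperator_add (M N : Matrix ι ι ℝ) (C : E →L[ℝ] E) :
    kroneckerOperator (M + N) C = kroneckerOperator M C + kroneckerOperator N C := by
  ext x i
  simp [kroneckerOperator_apply, add_smul, Finset.sum_add_distrib]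

theorem kroneckerOperator_neg (M : Matrix ι ι ℝ) (C : E →L[ℝ] E) :
    kroneckerOperator (-M) C = -kroneckerOperator M C := by
  ext x i
  simp [kroneckerOperator_apply]

theorem kroneckerOperator_one_left_apply [DecidableEq ι] (C : E →L[ℝ] E)
    (x : PiLp 2 (fun _ : ι => E)) (i : ι) : kroneckerOperator 1 C x i = C (x i) := by
  simp [kroneckerOperator_apply, Matrix.one_apply]

variable {H : Type*} [NormedAddCommGroup H] [InnerProductSpace ℝ H] [CompleteSpace H]

theorem star_kroneckerOperator (M : Matrix ι ι ℝ) (C : H →L[ℝ] H) :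
    star (kroneckerOperator M C) = kroneckerOperator M.transpose (star C) := by
  refine ((ContinuousLinearMap.eq_adjoint_iff _ _).2 fun x y => ?_).symm
  simp only [PiLp.inner_apply, kroneckerOperator_apply, sum_inner, inner_sum,
    real_inner_smul_left, real_inner_smul_right, Matrix.transpose_apply]
  rw [Finset.sum_comm]
  simp only [ContinuousLinearMap.star_eq_adjoint, C.adjoint_inner_left]

open scoped MatrixOrder in
theorem exists_transpose_mul_self {M : Matrix ι ι ℝ} (hM : M.PosSemidef) :
    ∃ B : Matrix ι ι ℝ, M = B.transpose * B := by
  classical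
  obtain ⟨B, hB⟩ := CStarAlgebra.nonneg_iff_eq_star_mul_self.1 hM.nonneg
  exact ⟨B, hB⟩

theorem inner_kroneckerOperator_one_self_nonpos {M : Matrix ι ι ℝ}
    (hM : (-(M + M.transpose)).PosSemidef) (x : PiLp 2 (fun _ : ι => H)) :
    inner ℝ (kroneckerOperator M 1 x) x ≤ 0 := by
  obtain ⟨B, hB⟩ := exists_transpose_mul_self hM
  set K := kroneckerOperator M (1 : H →L[ℝ] H) with hK
  set L := kroneckerOperator B (1 : H →L[ℝ] H) with hL
  have hadd : K + star K = -(star L * L) := by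
    rw [hK, hL, star_kroneckerOperator, star_kroneckerOperator, star_one, kroneckerOperator_mul,
      one_mul, ← hB, kroneckerOperator_neg, neg_neg, kroneckerOperator_add]
  have hinner : 2 * inner ℝ (K x) x = -‖L x‖ ^ 2 := by
    calc 2 * inner ℝ (K x) x = inner ℝ ((K + star K) x) x := by
          rw [add_apply, inner_add_left, ContinuousLinearMap.star_eq_adjoint,
            K.adjoint_inner_left, real_inner_comm x, two_mul]
      _ = -‖L x‖ ^ 2 := by
          rw [hadd, neg_apply, inner_neg_left, mul_apply_eq_comp,
            ContinuousLinearMap.star_eq_adjoint, L.adjoint_inner_left, real_inner_self_eq_norm_sq]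
  linarith [sq_nonneg ‖L x‖]

theorem isPositive_kroneckerOperator_one_left [DecidableEq ι] {T : H →L[ℝ] H}
    (hT : T.IsPositive) : (kroneckerOperator (1 : Matrix ι ι ℝ) T).IsPositive := by
  refine (ContinuousLinearMap.isPositive_iff' _).2 ⟨?_, fun x => ?_⟩
  · rw [IsSelfAdjoint, star_kroneckerOperator, Matrix.transpose_one, hT.isSelfAdjoint.star_eq]
  · simp only [PiLp.inner_apply, kroneckerOperator_one_left_apply]
    exact Finset.sum_nonneg fun i _ => hT.inner_nonneg_left (x i)

theorem exists_semigroup_matrix {T : H →L[ℝ] H} (hT : T.IsPositive)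
    (hinj : Function.Injective T) (M₀ : Matrix ι ι ℝ) {M₁ M₂ : Matrix ι ι ℝ}
    (hskew : M₁.transpose = -M₁) (hdiss : (-(M₂ + M₂.transpose)).PosSemidef) :
    ∃ S : ℝ≥0 → PiLp 2 (fun _ : ι => H) →L[ℝ] PiLp 2 (fun _ : ι => H),
      IsStronglyContinuousSemigroup S ∧ ∀ y : C(ℝ≥0, PiLp 2 (fun _ : ι => H)),
        (∀ i, HasHalfLineDeriv (fun t => T (T (y t i))) (fun t => ∑ j,
          (M₀ i j • T (T (y t j)) + M₁ i j • T (y t j) + M₂ i j • y t j))) ↔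
        ∀ t, y t = S t (y 0) := by
  classical
  have hinj' : Function.Injective (kroneckerOperator (1 : Matrix ι ι ℝ) T) := by
    intro x y hxy
    ext i
    refine hinj ?_
    rw [← kroneckerOperator_one_left_apply, hxy, kroneckerOperator_one_left_apply]
  have hcomm (M : Matrix ι ι ℝ) : Commute (kroneckerOperator 1 T) (kroneckerOperator M 1) := by
    simp only [Commute, SemiconjBy, kroneckerOperator_mul, one_mul, mul_one]
  have hskew' : kroneckerOperator M₁ (1 : H →L[ℝ] H) ∈ skewAdjoint _ := by
    rw [skewAdjoint.mem_iff, star_kroneckerOperator, hskew, kroneckerOperator_neg, star_one]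
  obtain ⟨S, hS, hy⟩ := exists_semigroup_quadratic (isPositive_kroneckerOperator_one_left hT) hinj'
    (hcomm M₀) (hcomm M₁) (hcomm M₂) hskew' (inner_kroneckerOperator_one_self_nonpos hdiss)
  refine ⟨S, hS, fun y => Iff.trans ?_ (hy y)⟩
  rw [HasHalfLineDeriv.piLp_iff]
  refine forall_congr' fun i => ?_
  simp only [pow_two, kroneckerOperator_mul, mul_one, one_mul, mul_apply_eq_comp, one_apply_eq_self,
    kroneckerOperator_apply, add_apply, PiLp.add_apply, Finset.sum_add_distrib, Matrix.one_apply,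
    ite_smul, one_smul, zero_smul, Finset.sum_ite_eq, Finset.mem_univ, if_true]

end KroneckerOperator

section SymmetrizedSystem

variable {E : Type*} [NormedAddCommGroup E] [NormedSpace ℝ E]

/-- `x = (p, q, w, θ)` solves the system for `p = A^{1/2} u`, `q = A^{1/2} v`, `w` and `θ`, written
in terms of the bounded operator `T = A^{-1/2}`. The powers of `T` on the left-hand sides turn every
equation into an identity in `E`. -/
structure IsSmoothedSolution (T : E →L[ℝ] E) (α β γ κ η : ℝ) (x : ℝ≥0 → E × E × E × E) : Prop where
  deriv_p : HasHalfLineDeriv (fun t => T (x t).1) (fun t => T (x t).2.1)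
  deriv_q : HasHalfLineDeriv (fun t => T (x t).2.1) (fun t => (x t).2.2.1)
  deriv_w : HasHalfLineDeriv (fun t => T (T (x t).2.2.1)) (fun t => -α • T (T (x t).2.2.1)
    - β • T (x t).2.1 - γ • T (x t).1 + η • (x t).2.2.2)
  deriv_θ : HasHalfLineDeriv (fun t => T (T (x t).2.2.2)) (fun t => -κ • (x t).2.2.2
    - η • (x t).2.2.1 - (α * η) • T (x t).2.1)

/-- The coordinates `(b p, b (q + δ p), w + α T q, θ)`, in which the system of
`IsSmoothedSolution` becomes skew-symmetric and dissipative up to a bounded term, provided that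
`b² = β` and `b² δ = γ`. -/
noncomputable def symmetrizer (T : E →L[ℝ] E) (α δ : ℝ) {b : ℝ} (hb : b ≠ 0) :
    (E × E × E × E) ≃L[ℝ] PiLp 2 (fun _ : Fin 4 => E) where
  toFun x := !₂[b • x.1, b • (x.2.1 + δ • x.1), x.2.2.1 + α • T x.2.1, x.2.2.2]
  invFun y := (b⁻¹ • y 0, b⁻¹ • y 1 - δ • b⁻¹ • y 0,
    y 2 - α • T (b⁻¹ • y 1 - δ • b⁻¹ • y 0), y 3)
  map_add' x y := by
    ext i
    fin_cases i <;> simp <;> module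
  map_smul' c x := by
    ext i
    fin_cases i <;> simp <;> module
  left_inv x := by
    simp [hb]
  right_inv y := by
    ext i
    fin_cases i <;> simp [hb]
  continuous_toFun := by
    refine (PiLp.continuous_toLp 2 _).comp (continuous_pi fun i => ?_)
    fin_cases i <;>
      simp only [Fin.zero_eta, Fin.mk_one, Fin.reduceFinMk, Matrix.cons_val] <;> fun_prop
  continuous_invFun := by
    fun_prop

/-- The bounded part of the system in the coordinates of `symmetrizer`. -/
def boundedPart (α δ : ℝ) : Matrix (Fin 4) (Fin 4) ℝ :=
  !![-δ, 1, 0, 0; -((δ - α) * δ), δ - α, 0, 0; 0, 0, 0, 0; 0, 0, 0, 0]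

/-- The coefficient of `A^{1/2}` in the coordinates of `symmetrizer`. -/
def wavePart (b : ℝ) : Matrix (Fin 4) (Fin 4) ℝ :=
  !![0, 0, 0, 0; 0, 0, b, 0; 0, -b, 0, 0; 0, 0, 0, 0]

/-- The coefficient of `A` in the coordinates of `symmetrizer`. -/
def heatPart (κ η : ℝ) : Matrix (Fin 4) (Fin 4) ℝ :=
  !![0, 0, 0, 0; 0, 0, 0, 0; 0, 0, 0, η; 0, 0, -η, -κ]

theorem transpose_wavePart (b : ℝ) : (wavePart b).transpose = -wavePart b := by
  ext i j
  fin_cases i <;> fin_cases j <;> simp [wavePart]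

theorem posSemidef_neg_heatPart_add_transpose {κ : ℝ} (hκ : 0 ≤ κ) (η : ℝ) :
    (-(heatPart κ η + (heatPart κ η).transpose)).PosSemidef := by
  have hdiag : -(heatPart κ η + (heatPart κ η).transpose) =
      Matrix.diagonal ![0, 0, 0, 2 * κ] := by
    ext i j
    fin_cases i <;> fin_cases j <;> simp [heatPart, two_mul]
  rw [hdiag, Matrix.posSemidef_diagonal_iff]
  intro i
  fin_cases i <;> simp [hκ]

theorem map_map_symmetrizer (T : E →L[ℝ] E) (α δ : ℝ) {b : ℝ} (hb : b ≠ 0) (x : E × E × E × E)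
    (i : Fin 4) : T (T (symmetrizer T α δ hb x i)) =
      ![b • T (T x.1), (b * δ) • T (T x.1) + b • T (T x.2.1),
        α • T (T (T x.2.1)) + T (T x.2.2.1), T (T x.2.2.2)] i := by
  fin_cases i <;> simp [symmetrizer] <;> module

theorem sum_symmetrizer (T : E →L[ℝ] E) (α δ κ η : ℝ) {b : ℝ} (hb : b ≠ 0)
    (x : E × E × E × E) (i : Fin 4) :
    ∑ j, (boundedPart α δ i j • T (T (symmetrizer T α δ hb x j)) +
      wavePart b i j • T (symmetrizer T α δ hb x j) +
      heatPart κ η i j • symmetrizer T α δ hb x j) =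
    ![b • T (T x.2.1), (b * δ) • T (T x.2.1) + b • T x.2.2.1,
      α • T (T x.2.2.1) + (-α • T (T x.2.2.1) - b ^ 2 • T x.2.1 - (b ^ 2 * δ) • T x.1 +
        η • x.2.2.2),
      -κ • x.2.2.2 - η • x.2.2.1 - (α * η) • T x.2.1] i := by
  fin_cases i <;>
    simp [symmetrizer, boundedPart, wavePart, heatPart, Fin.sum_univ_four] <;> module

theorem isSmoothedSolution_iff [CompleteSpace E] {T : E →L[ℝ] E} (hT : Function.Injective T)
    {α δ κ η b : ℝ} (hb : b ≠ 0) {x : ℝ≥0 → E × E × E × E} (hx : Continuous x) :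
    IsSmoothedSolution T α (b ^ 2) (b ^ 2 * δ) κ η x ↔
      ∀ i, HasHalfLineDeriv (fun t => T (T (symmetrizer T α δ hb (x t) i))) (fun t => ∑ j,
        (boundedPart α δ i j • T (T (symmetrizer T α δ hb (x t) j)) +
          wavePart b i j • T (symmetrizer T α δ hb (x t) j) +
          heatPart κ η i j • symmetrizer T α δ hb (x t) j)) := by
  simp only [sum_symmetrizer]
  simp only [map_map_symmetrizer]
  have hbT : Function.Injective (b • T) := (smul_right_injective E hb).comp hT
  have hp := HasHalfLineDeriv.clm_apply_iff (f := fun t => T (x t).1) (g := fun t => T (x t).2.1)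
    hbT (by fun_prop)
  have hq := HasHalfLineDeriv.clm_apply_iff (f := fun t => T (x t).2.1)
    (g := fun t => (x t).2.2.1) hbT (by fun_prop)
  constructor
  · rintro ⟨h₁, h₂, h₃, h₄⟩ i
    fin_cases i
    · exact hp.2 h₁
    · exact ((h₁.clm_apply T).const_smul (b * δ)).add (hq.2 h₂)
    · exact (((h₂.clm_apply T).clm_apply T).const_smul α).add h₃
    · exact h₄
  · intro h
    have h₁ := hp.1 (h 0)
    have h₂ := hq.1 (((h₁.clm_apply T).const_smul (b * δ)).add_iff_right.1 (h 1))
    exact ⟨h₁, h₂, (((h₂.clm_apply T).clm_apply T).const_smul α).add_iff_right.1 (h 2), h 3⟩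

end SymmetrizedSystem

theorem IsStronglyContinuousSemigroup.conj {X Y : Type*} [NormedAddCommGroup X] [NormedSpace ℝ X]
    [NormedAddCommGroup Y] [NormedSpace ℝ Y] {S : ℝ≥0 → Y →L[ℝ] Y}
    (hS : IsStronglyContinuousSemigroup S) (Φ : X ≃L[ℝ] Y) :
    IsStronglyContinuousSemigroup fun t =>
      (Φ.symm : Y →L[ℝ] X) ∘L S t ∘L (Φ : X →L[ℝ] Y) where
  zero := by
    ext x
    simp [hS.zero]
  add s t := by
    ext x
    simp [hS.add]
  continuous x := Φ.symm.continuous.comp (hS.continuous (Φ x))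

namespace StrictlyPositiveOperator

variable {H : Type*} [NormedAddCommGroup H] [InnerProductSpace ℝ H] [CompleteSpace H]
variable (A : StrictlyPositiveOperator H)

theorem norm_sqrtMap (u : A.H1) : ‖A.sqrtMap u‖ = ‖u‖ := by
  have hinner : inner ℝ (A.sqrtMap u) (A.sqrtMap u) = inner ℝ u u := rfl
  rw [norm_eq_sqrt_real_inner, norm_eq_sqrt_real_inner, hinner]

theorem mem_graph_sqrt_iff {x z : H} :
    (x, z) ∈ A.sqrt.graph ↔ ∃ u : A.H1, A.incl u = x ∧ A.sqrtMap u = z :=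
  A.sqrt.mem_graph_iff

theorem sqrtMap_surjective : Function.Surjective A.sqrtMap := by
  obtain ⟨_, _, G, hG, _, _⟩ := A.exists_inverse
  intro y
  obtain ⟨z, _, hz⟩ := (A.isPositiveSqrt_sqrt.mem_graph_iff _ _).1 ((hG (G y) y).2 rfl)
  obtain ⟨u, _, hu⟩ := A.mem_graph_sqrt_iff.1 hz
  exact ⟨u, hu⟩

/-- `A^{1/2}` as an isometry of `H¹` onto `H`. -/
noncomputable def sqrtIsometry : A.H1 ≃ₗᵢ[ℝ] H :=
  LinearIsometryEquiv.ofSurjective ⟨A.sqrtMap, A.norm_sqrtMap⟩ A.sqrtMap_surjective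

theorem sqrtMap_symm (x : H) : A.sqrtMap (A.sqrtIsometry.symm x) = x :=
  A.sqrtIsometry.apply_symm_apply x

theorem inner_sqrtMap_incl (u v : A.H1) :
    inner ℝ (A.sqrtMap u) (A.incl v) = inner ℝ (A.incl u) (A.sqrtMap v) := by
  have hs := A.isPositiveSqrt_sqrt.isSelfAdjoint
  have hu : (A.incl u, A.sqrtMap u) ∈ A.sqrt.graph := A.mem_graph_sqrt_iff.2 ⟨u, rfl, rfl⟩
  have hv : (A.incl v, A.sqrtMap v) ∈ A.sqrt.graph.adjoint := by
    rw [← LinearPMap.adjoint_graph_eq_graph_adjoint hs.dense_domain,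
      LinearPMap.isSelfAdjoint_def.1 hs]
    exact A.mem_graph_sqrt_iff.2 ⟨v, rfl, rfl⟩
  exact sub_eq_zero.1 ((Submodule.mem_adjoint_iff _ _).1 hv _ _ hu)

theorem isSymmetric_incl_comp_symm :
    (A.incl ∘ₗ A.sqrtIsometry.symm.toLinearEquiv.toLinearMap).IsSymmetric := by
  intro x y
  have h := A.inner_sqrtMap_incl (A.sqrtIsometry.symm x) (A.sqrtIsometry.symm y)
  rw [sqrtMap_symm, sqrtMap_symm] at h
  exact h.symm

/-- The bounded operator `A^{-1/2}`; its continuity is the Hellinger–Toeplitz theorem. -/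
noncomputable def invSqrt : H →L[ℝ] H :=
  ⟨A.incl ∘ₗ A.sqrtIsometry.symm.toLinearEquiv.toLinearMap, A.isSymmetric_incl_comp_symm.continuous⟩

theorem invSqrt_sqrtMap (u : A.H1) : A.invSqrt (A.sqrtMap u) = A.incl u :=
  congrArg A.incl (A.sqrtIsometry.symm_apply_apply u)

theorem inner_invSqrt_left (x y : H) : inner ℝ (A.invSqrt x) y = inner ℝ x (A.invSqrt y) :=
  A.isSymmetric_incl_comp_symm x y

theorem isPositive_invSqrt : A.invSqrt.IsPositive := by
  refine ⟨A.isSymmetric_incl_comp_symm, fun x => ?_⟩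
  obtain ⟨u, rfl⟩ := A.sqrtMap_surjective x
  rw [ContinuousLinearMap.reApplyInnerSelf_apply, invSqrt_sqrtMap, inner_re_symm]
  exact A.isPositiveSqrt_sqrt.nonneg u

theorem invSqrt_injective : Function.Injective A.invSqrt :=
  Subtype.val_injective.comp A.sqrtIsometry.symm.injective

theorem mem_graph_op_iff {x y : H} : (x, y) ∈ A.op.graph ↔ x = A.invSqrt (A.invSqrt y) := by
  rw [A.isPositiveSqrt_sqrt.mem_graph_iff]
  constructor
  · rintro ⟨z, hxz, hzy⟩
    obtain ⟨u, rfl, rfl⟩ := A.mem_graph_sqrt_iff.1 hxz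
    obtain ⟨v, hv, rfl⟩ := A.mem_graph_sqrt_iff.1 hzy
    rw [invSqrt_sqrtMap, hv, invSqrt_sqrtMap]
  · rintro rfl
    obtain ⟨v, rfl⟩ := A.sqrtMap_surjective y
    obtain ⟨u, hu⟩ := A.sqrtMap_surjective (A.incl v)
    rw [invSqrt_sqrtMap, ← hu, invSqrt_sqrtMap]
    exact ⟨A.incl v, A.mem_graph_sqrt_iff.2 ⟨u, rfl, hu⟩, A.mem_graph_sqrt_iff.2 ⟨v, rfl, rfl⟩⟩

theorem inner_invSqrt_invSqrt_op (x : H) (φ : A.op.domain) :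
    inner ℝ (A.invSqrt (A.invSqrt x)) (A.op φ) = inner ℝ x (φ : H) := by
  rw [inner_invSqrt_left, inner_invSqrt_left, ← A.mem_graph_op_iff.1 (A.op.mem_graph φ)]

theorem op_surjective : Function.Surjective A.op := by
  intro y
  have hy : (A.invSqrt (A.invSqrt y), y) ∈ A.op.graph := A.mem_graph_op_iff.2 rfl
  obtain ⟨φ, _, hφ⟩ := A.op.mem_graph_iff.1 hy
  exact ⟨φ, hφ⟩

theorem hasHalfLineDeriv_invSqrt_invSqrt_iff {f g : ℝ≥0 → H} (hg : Continuous g) :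
    HasHalfLineDeriv (fun t => A.invSqrt (A.invSqrt (f t))) g ↔ ∀ φ : A.op.domain,
      HasHalfLineDeriv (fun t => inner ℝ (f t) (φ : H)) (fun t => inner ℝ (g t) (A.op φ)) := by
  have htest (φ : A.op.domain) :
      (fun t => inner ℝ (f t) (φ : H)) =
        fun t => innerSL ℝ (A.op φ) (A.invSqrt (A.invSqrt (f t))) := by
    ext t
    rw [innerSL_apply_apply, real_inner_comm (A.invSqrt _), inner_invSqrt_invSqrt_op]
  have htest' (φ : A.op.domain) :
      (fun t => inner ℝ (g t) (A.op φ)) = fun t => innerSL ℝ (A.op φ) (g t) := by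
    ext t
    exact real_inner_comm _ _
  simp only [htest, htest']
  refine ⟨fun h φ => h.clm_apply _, HasHalfLineDeriv.of_separating (fun x hx => ?_) hg⟩
  obtain ⟨φ, rfl⟩ := A.op_surjective x
  exact inner_self_eq_zero.1 (hx φ)

/-- The map `(u, v, w, θ) ↦ (A^{1/2} u, A^{1/2} v, w, θ)`. -/
noncomputable def sqrtProd : A.PhaseSpace ≃L[ℝ] H × H × H × H :=
  A.sqrtIsometry.toContinuousLinearEquiv.prodCongr
    (A.sqrtIsometry.toContinuousLinearEquiv.prodCongr (.refl ℝ (H × H)))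

theorem isWeakSolution_iff {α β γ κ η : ℝ} {z : A.PhaseSpace} {U : C(ℝ≥0, A.PhaseSpace)} :
    A.IsWeakSolution α β γ κ η z U ↔
      U 0 = z ∧ IsSmoothedSolution A.invSqrt α β γ κ η (fun t => A.sqrtProd (U t)) := by
  have hU : Continuous fun t => A.sqrtProd (U t) := by fun_prop
  have hu (t : ℝ≥0) : A.incl (U t).1 = A.invSqrt (A.sqrtProd (U t)).1 :=
    (A.invSqrt_sqrtMap _).symm
  have hv (t : ℝ≥0) : A.incl (U t).2.1 = A.invSqrt (A.sqrtProd (U t)).2.1 :=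
    (A.invSqrt_sqrtMap _).symm
  have hw := A.hasHalfLineDeriv_invSqrt_invSqrt_iff (f := fun t => (U t).2.2.1)
    (g := fun t => -α • A.invSqrt (A.invSqrt (U t).2.2.1) - β • A.incl (U t).2.1
      - γ • A.incl (U t).1 + η • (U t).2.2.2) (by simp only [hu, hv]; fun_prop)
  have hθ := A.hasHalfLineDeriv_invSqrt_invSqrt_iff (f := fun t => (U t).2.2.2)
    (g := fun t => -κ • (U t).2.2.2 - η • (U t).2.2.1 - (α * η) • A.incl (U t).2.1)
    (by simp only [hv]; fun_prop)
  simp only [inner_add_left, inner_sub_left, real_inner_smul_left,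
    inner_invSqrt_invSqrt_op] at hw hθ
  simp only [hu, hv] at hw hθ
  constructor
  · rintro ⟨h₀, h₁, h₂, h₃, h₄⟩
    simp only [hu, hv] at h₁ h₂ h₃ h₄
    exact ⟨h₀, h₁, h₂, hw.2 h₃, hθ.2 h₄⟩
  · rintro ⟨h₀, h₁, h₂, h₃, h₄⟩
    refine ⟨h₀, ?_, ?_, ?_, ?_⟩ <;> simp only [hu, hv]
    exacts [h₁, h₂, hw.1 h₃, hθ.1 h₄]

theorem exists_semigroup_isWeakSolution_iff (α γ η : ℝ) {β κ : ℝ} (hβ : 0 < β) (hκ : 0 ≤ κ) :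
    ∃ S : ℝ≥0 → A.PhaseSpace →L[ℝ] A.PhaseSpace, IsStronglyContinuousSemigroup S ∧
      ∀ (z : A.PhaseSpace) (U : C(ℝ≥0, A.PhaseSpace)),
        A.IsWeakSolution α β γ κ η z U ↔ ∀ t, U t = S t z := by
  obtain ⟨b, hb, rfl⟩ : ∃ b : ℝ, b ≠ 0 ∧ b ^ 2 = β :=
    ⟨√β, (Real.sqrt_pos.2 hβ).ne', Real.sq_sqrt hβ.le⟩
  obtain ⟨δ, rfl⟩ : ∃ δ : ℝ, b ^ 2 * δ = γ := ⟨γ / b ^ 2, mul_div_cancel₀ γ hβ.ne'⟩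
  obtain ⟨S, hS, hS_iff⟩ := exists_semigroup_matrix A.isPositive_invSqrt A.invSqrt_injective
    (boundedPart α δ) (transpose_wavePart b) (posSemidef_neg_heatPart_add_transpose hκ η)
  let Φ := A.sqrtProd.trans (symmetrizer A.invSqrt α δ hb)
  refine ⟨_, hS.conj Φ, fun z U => ?_⟩
  have hU : A.IsWeakSolution α (b ^ 2) (b ^ 2 * δ) κ η z U ↔
      U 0 = z ∧ ∀ t, Φ (U t) = S t (Φ (U 0)) := by
    rw [A.isWeakSolution_iff, isSmoothedSolution_iff A.invSqrt_injective hb (by fun_prop)]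
    exact and_congr_right fun _ => hS_iff ⟨fun t => Φ (U t), by fun_prop⟩
  rw [hU]
  constructor
  · rintro ⟨rfl, h⟩ t
    exact Φ.eq_symm_apply.2 (h t)
  · intro h
    have hz : U 0 = z := by simpa [hS.zero] using h 0
    exact ⟨hz, fun t => hz ▸ Φ.eq_symm_apply.1 (h t)⟩

end StrictlyPositiveOperator

theorem theorem4p2_general {H : Type*} [NormedAddCommGroup H] [InnerProductSpace ℝ H]
    [CompleteSpace H] (A : StrictlyPositiveOperator H) (α γ η : ℝ) {β κ : ℝ} (hβ : 0 < β)
    (hκ : 0 ≤ κ) :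
    (∀ z : A.PhaseSpace, ∃! U : C(ℝ≥0, A.PhaseSpace), A.IsWeakSolution α β γ κ η z U) ∧
    ∃ S : ℝ≥0 → A.PhaseSpace →L[ℝ] A.PhaseSpace,
      IsStronglyContinuousSemigroup S ∧
      ∀ (z : A.PhaseSpace) (U : C(ℝ≥0, A.PhaseSpace)), A.IsWeakSolution α β γ κ η z U →
        ∀ t : ℝ≥0, U t = S t z := by
  obtain ⟨S, hS, hS_iff⟩ := A.exists_semigroup_isWeakSolution_iff α γ η hβ hκ
  refine ⟨fun z => ⟨⟨fun t => S t z, hS.continuous z⟩, (hS_iff z _).2 fun _ => rfl, ?_⟩,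
    S, hS, fun z U => (hS_iff z U).1⟩
  exact fun V hV => ContinuousMap.ext ((hS_iff z V).1 hV)

theorem theorem4p2 {H : Type*} [NormedAddCommGroup H] [InnerProductSpace ℝ H] [CompleteSpace H]
    (A : StrictlyPositiveOperator H) {α β γ κ : ℝ} (hα : 0 < α) (hβ : 0 < β) (hγ : 0 < γ)
    (hκ : 0 < κ) (η : ℝ) :
    (∀ z : A.PhaseSpace, ∃! U : C(ℝ≥0, A.PhaseSpace), A.IsWeakSolution α β γ κ η z U) ∧
    ∃ S : ℝ≥0 → A.PhaseSpace →L[ℝ] A.PhaseSpace,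
      IsStronglyContinuousSemigroup S ∧
      ∀ (z : A.PhaseSpace) (U : C(ℝ≥0, A.PhaseSpace)), A.IsWeakSolution α β γ κ η z U →
        ∀ t : ℝ≥0, U t = S t z := by
  exact theorem4p2_general A α γ η hβ hκ.le
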